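/- Let $d\in\mathbb N$ and $[d]=\{1,\dots,d\}$. Let $\mu:2^{[d]}\to(0,\infty)$ be a finite (everywhere positive) weighting function, and let $\mathcal E$ be the Faith-Interaction index with respect to $\mu$: for every set function $v:2^{[d]}\to\mathbb R$ and every maximum interaction order $\ell\in\{1,\dots,d\}$, the vector $\mathcal E(v,\ell)=(\mathcal E_T(v,\ell))_{T\subseteq[d],\,|T|\le\ell}$ minimizes $$x\;\longmapsto\;\sum_{S\subseteq[d]}\mu(S)\Bigl(v(S)-\sum_{T\subseteq S,\ |T|\le\ell}x_T\Bigr)^2$$ over all real vectors $x=(x_T)_{T\subseteq[d],\,|T|\le\ell}$. Consider the following axioms, each required for all $\ell\in\{1,\dots,d\}$. * Interaction linearity: $\mathcal E(\alpha_1v_1+\alpha_2v_2,\ell)=\alpha_1\mathcal E(v_1,\ell)+\alpha_2\mathcal E(v_2,\ell)$ for all set functions $v_1,v_2$ and all $\alpha_1,\alpha_2\in\mathbb R$. * Interaction symmetry: if $i,j\in[d]$ and $v(S\cup\{i\})=v(S\cup\{j\})$ for all $S\subseteq[d]\setminus\{i,j\}$, then $\mathcal E_{T\cup\{i\}}(v,\ell)=\mathcal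 E_{T\cup\{j\}}(v,\ell)$ for all $T\subseteq[d]\setminus\{i,j\}$ with $|T|<\ell$. * Interaction dummy: if $i\in[d]$ and $v(S\cup\{i\})=v(S)$ for all $S\subseteq[d]\setminus\{i\}$, then $\mathcal E_T(v,\ell)=0$ for all $T\subseteq[d]$ with $|T|\le\ell$ and $i\in T$. Then $\mathcal E$ satisfies interaction linearity, interaction symmetry and interaction dummy if and only if there exist real numbers $a>b>0$ such that the numbers $$g(a,b,i)=\prod_{j=0}^{i-1}\frac{a(a-b)+j(b-a^2)}{a-b+j(b-a^2)}\qquad(0\le i\le d,\quad g(a,b,0)=1)$$ are well defined (all denominators, for $0\le j\le d-1$, are nonzero), the quantity $$w(S)=\sum_{i=|S|}^{d}\binom{d-|S|}{i-|S|}(-1)^{i-|S|}\,g(a,b,i)$$ is positive for every $S\subseteq[d]$, and $\mu$ is proportional to $w$, i.e. there is a constant $c>0$ with $\mu(S)=c\,w(S)$ for all $S\subseteq[d]$. -/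

import Mathlib

open scoped ENNReal

noncomputable section

namespace FaithInteraction

/-- A set (value) function on coalitions of the features `[d]`. -/
abbrev SetFun (d : ℕ) := Finset (Fin d) → ℝ

/-- The coalitions of size at most `ℓ` (including the empty one). -/
abbrev Coalition (d ℓ : ℕ) := {S : Finset (Fin d) // S.card ≤ ℓ}

/-- An interaction index assigns to every set function `v` and every maximum interaction order `ℓ`
a vector indexed by the coalitions of size at most `ℓ`. Only the orders `1 ≤ ℓ ≤ d` are used. -/
abbrev InteractionIndex (d : ℕ) := SetFun d → (ℓ : ℕ) → Coalition d ℓ → ℝ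

variable {d : ℕ}

/-! ### Weighted regression and Faith-Interaction indices -/

/-- A proper weighting function: positive everywhere, possibly infinite, but infinite at most at
the empty set and at the full set. -/
structure IsProperWeighting (μ : Finset (Fin d) → ℝ≥0∞) : Prop where
  pos : ∀ S, 0 < μ S
  ne_top : ∀ S, S ≠ ∅ → S ≠ Finset.univ → μ S ≠ ∞

/-- The value at `S` of the polynomial approximation with coefficients `x`:
the sum of `x T` over `T ⊆ S` with `|T| ≤ ℓ`. -/
def approx {ℓ : ℕ} (x : Coalition d ℓ → ℝ) (S : Finset (Fin d)) : ℝ :=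
  ∑ T : Coalition d ℓ with T.1 ⊆ S, x T

/-- The weighted squared error, over the coalitions of finite weight. -/
def loss {ℓ : ℕ} (μ : Finset (Fin d) → ℝ≥0∞) (v : SetFun d) (x : Coalition d ℓ → ℝ) : ℝ :=
  ∑ S : Finset (Fin d) with μ S ≠ ∞, (μ S).toReal * (v S - approx x S) ^ 2

/-- The coefficient vectors that fit `v` exactly at every coalition of infinite weight. -/
def feasible (ℓ : ℕ) (μ : Finset (Fin d) → ℝ≥0∞) (v : SetFun d) : Set (Coalition d ℓ → ℝ) :=
  {x | ∀ S, μ S = ∞ → v S = approx x S}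

/-- `E` is the Faith-Interaction index with respect to the (proper) weighting function `μ`:
for every `v` and every order `ℓ ∈ [d]`, `E v ℓ` solves the constrained weighted regression. -/
structure IsFaithInteractionIndex (μ : Finset (Fin d) → ℝ≥0∞) (E : InteractionIndex d) :
    Prop where
  proper : IsProperWeighting μ
  mem_feasible : ∀ (v : SetFun d) (ℓ : ℕ), 1 ≤ ℓ → ℓ ≤ d → E v ℓ ∈ feasible ℓ μ v
  isMinOn : ∀ (v : SetFun d) (ℓ : ℕ), 1 ≤ ℓ → ℓ ≤ d → IsMinOn (loss μ v) (feasible ℓ μ v) (E v ℓ)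

/-! ### Axioms for interaction indices -/

def InteractionLinearity (E : InteractionIndex d) : Prop :=
  ∀ ℓ : ℕ, 1 ≤ ℓ → ℓ ≤ d → ∀ (v₁ v₂ : SetFun d) (α₁ α₂ : ℝ),
    E (α₁ • v₁ + α₂ • v₂) ℓ = α₁ • E v₁ ℓ + α₂ • E v₂ ℓ

def InteractionSymmetry (E : InteractionIndex d) : Prop :=
  ∀ ℓ : ℕ, 1 ≤ ℓ → ℓ ≤ d → ∀ (v : SetFun d) (i j : Fin d),
    (∀ S : Finset (Fin d), i ∉ S → j ∉ S → v (insert i S) = v (insert j S)) →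
    ∀ (T : Finset (Fin d)) (_ : i ∉ T) (_ : j ∉ T) (hT : T.card < ℓ),
      E v ℓ ⟨insert i T, (Finset.card_insert_le i T).trans hT⟩ =
        E v ℓ ⟨insert j T, (Finset.card_insert_le j T).trans hT⟩

def InteractionDummy (E : InteractionIndex d) : Prop :=
  ∀ ℓ : ℕ, 1 ≤ ℓ → ℓ ≤ d → ∀ (v : SetFun d) (i : Fin d),
    (∀ S : Finset (Fin d), i ∉ S → v (insert i S) = v S) →
    ∀ T : Coalition d ℓ, i ∈ T.1 → E v ℓ T = 0

/-! ### The two-parameter family of weights -/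

/-- `g(a, b, i) = ∏_{j = 0}^{i - 1} (a(a - b) + j(b - a²)) / (a - b + j(b - a²))`,
the empty product being `1`. -/
def g (a b : ℝ) (i : ℕ) : ℝ :=
  ∏ j ∈ Finset.range i, (a * (a - b) + j * (b - a ^ 2)) / (a - b + j * (b - a ^ 2))

/-- `∑_{i = |S|}^{d} C(d - |S|, i - |S|) (-1)^{i - |S|} g(a, b, i)`. -/
def weight (a b : ℝ) (S : Finset (Fin d)) : ℝ :=
  ∑ i ∈ Finset.Icc S.card d,
    ((d - S.card).choose (i - S.card) : ℝ) * (-1) ^ (i - S.card) * g a b i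

end FaithInteraction

end

/-! As all weights are finite, a fit of order `ℓ` obeys normal equations: the weighted residual is
orthogonal to every polynomial of degree at most `ℓ`. Positivity of the weights makes the solution
unique, so linearity is automatic, and symmetry holds once the weight `M |S|` depends on size alone.

The pivot is `IsAffineWeight`: `M (s + 1) / (M s + M (s + 1))` is affine in `s`. Solving this
recursion gives Pólya urn weights `∏_{j<s} (A + jC) * ∏_{j<d-s} (B + jC)`, where `C` may be
negative. The family `weight a b` has the same form, since its alternating sum is an iterated
difference of `g` (`weight_eq_prod`).

Necessity: fit a monomial one degree above the allowed order. The normal equations force the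
weighted residuals to alternate in sign up to one nonzero constant, so invariance of the residual
under a swap, or under removal of a dummy feature, becomes a condition on the weights
(`InteractionSymmetry.weight_eq_of_card_eq`, `InteractionDummy.isAffineWeight`).

Sufficiency for dummy: affinity makes a suitable test polynomial have degree at most `ℓ`, and
testing with it shows that the part of the fit involving the dummy vanishes
(`NormalEq.coeff_eq_zero`). -/

namespace FaithInteraction

/-! ### Normal equations of the regression. -/

section Regression

variable {d ℓ : ℕ}

/-- The coefficient of `T` in `x`, extended by zero to coalitions larger than `ℓ`. -/
def coeff (x : Coalition d ℓ → ℝ) (T : Finset (Fin d)) : ℝ :=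
  if h : T.card ≤ ℓ then x ⟨T, h⟩ else 0

lemma coeff_coe (x : Coalition d ℓ → ℝ) (T : Coalition d ℓ) : coeff x T.1 = x T := by
  simp [coeff, T.2]

lemma coeff_of_le (x : Coalition d ℓ → ℝ) {T : Finset (Fin d)} (h : T.card ≤ ℓ) :
    coeff x T = x ⟨T, h⟩ := by
  simp [coeff, h]

lemma coeff_of_lt (x : Coalition d ℓ → ℝ) {T : Finset (Fin d)} (h : ℓ < T.card) :
    coeff x T = 0 := by
  simp [coeff, h]

lemma approx_eq_sum_powerset (x : Coalition d ℓ → ℝ) (S : Finset (Fin d)) :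
    approx x S = ∑ T ∈ S.powerset, coeff x T := by
  have h1 : approx x S = ∑ T : Coalition d ℓ, if T.1 ⊆ S then coeff x T.1 else 0 := by
    rw [approx, Finset.sum_filter]
    exact Finset.sum_congr rfl fun T _ => by rw [coeff_coe]
  have h2 := Finset.sum_subtype (F := inferInstance) (Finset.univ.filter fun T : Finset (Fin d) => T.card ≤ ℓ)
    (p := fun T => T.card ≤ ℓ) (by simp) (fun T => if T ⊆ S then coeff x T else 0)
  rw [h1, ← h2, Finset.sum_filter, ← Finset.filter_subset_univ S, Finset.sum_filter]
  refine Finset.sum_congr rfl fun T _ => ?_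
  split_ifs with h3 h4 h4 <;> first | rfl | exact (coeff_of_lt x (not_le.1 h3)).symm

lemma approx_add_smul (x y : Coalition d ℓ → ℝ) (t : ℝ) (S : Finset (Fin d)) :
    approx (x + t • y) S = approx x S + t * approx y S := by
  simp [approx, Finset.sum_add_distrib, Finset.mul_sum]

lemma approx_single (T : Coalition d ℓ) (S : Finset (Fin d)) :
    approx (Pi.single T 1) S = if T.1 ⊆ S then 1 else 0 := by
  simp [approx]

/-- The coefficients are determined by the values at the coalitions of size at most `ℓ`. -/
lemma eq_zero_of_approx_eq_zero {x : Coalition d ℓ → ℝ}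
    (h : ∀ S : Finset (Fin d), S.card ≤ ℓ → approx x S = 0) : x = 0 := by
  have key : ∀ S : Finset (Fin d), S.card ≤ ℓ → coeff x S = 0 := by
    intro S
    induction S using Finset.strongInduction with
    | H S ih =>
      intro hS
      have h1 := h S hS
      rw [approx_eq_sum_powerset, Finset.sum_eq_single_of_mem S (Finset.mem_powerset_self S)] at h1
      · exact h1
      · intro T hT hne
        have hss : T ⊂ S := (Finset.mem_powerset.1 hT).ssubset_of_ne hne
        exact ih T hss ((Finset.card_le_card hss.1).trans hS)
  funext T
  exact (coeff_coe x T).symm.trans (key T.1 T.2)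

/-- The residual of the fit `x` of `v` is orthogonal to all polynomials of degree at most `ℓ`. -/
def NormalEq (m : Finset (Fin d) → ℝ) (v : SetFun d) (x : Coalition d ℓ → ℝ) : Prop :=
  ∀ y : Coalition d ℓ → ℝ, ∑ S, m S * (v S - approx x S) * approx y S = 0

/-- Testing both equations with `x - y` shows that `x - y` has weighted norm zero. -/
lemma NormalEq.unique {m : Finset (Fin d) → ℝ} (hm : ∀ S, 0 < m S) {v : SetFun d}
    {x y : Coalition d ℓ → ℝ} (hx : NormalEq m v x) (hy : NormalEq m v y) : x = y := by
  have h : ∑ S, m S * approx (x + (-1 : ℝ) • y) S ^ 2 = 0 := by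
    have := congrArg₂ (· - ·) (hy (x + (-1 : ℝ) • y)) (hx (x + (-1 : ℝ) • y))
    simp only [← Finset.sum_sub_distrib, sub_zero] at this
    rw [← this]
    refine Finset.sum_congr rfl fun S _ => ?_
    rw [approx_add_smul]
    ring
  rw [Finset.sum_eq_zero_iff_of_nonneg fun S _ => by have := hm S; positivity] at h
  have h0 : x + (-1 : ℝ) • y = 0 := eq_zero_of_approx_eq_zero fun S _ => by
    simpa [(hm S).ne'] using h S (Finset.mem_univ S)
  funext T
  have := congrFun h0 T
  simp at this
  linarith

lemma NormalEq.sum_superset {m : Finset (Fin d) → ℝ} {v : SetFun d} {x : Coalition d ℓ → ℝ}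
    (h : NormalEq m v x) {T : Finset (Fin d)} (hT : T.card ≤ ℓ) :
    ∑ S, m S * (v S - approx x S) * (if T ⊆ S then 1 else 0) = 0 := by
  simpa only [approx_single] using h (Pi.single ⟨T, hT⟩ 1)

/-- Orthogonality to the monomial of `Uᶜ`, whose supersets are the complements of the subsets of
`U`. -/
lemma NormalEq.sum_compl {m : Finset (Fin d) → ℝ} {v : SetFun d} {x : Coalition d ℓ → ℝ}
    (h : NormalEq m v x) {U : Finset (Fin d)} (hU : d ≤ U.card + ℓ) :
    ∑ K ∈ U.powerset, m Kᶜ * (v Kᶜ - approx x Kᶜ) = 0 := by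
  have h1 := h.sum_superset (T := Uᶜ) (by rw [Finset.card_compl, Fintype.card_fin]; omega)
  simp only [mul_ite, mul_one, mul_zero] at h1
  rw [← Finset.sum_filter] at h1
  rw [← h1]
  refine Finset.sum_nbij' (fun K => Kᶜ) (fun K => Kᶜ) ?_ ?_ ?_ ?_ ?_
  · intro K hK
    simpa using hK
  · intro K hK
    simp only [Finset.mem_filter, Finset.mem_univ, true_and] at hK
    rw [Finset.mem_powerset]
    exact compl_le_iff_compl_le.1 hK
  · simp
  · simp
  · simp

lemma IsFaithInteractionIndex.normalEq {μ : Finset (Fin d) → ℝ≥0∞} (hμ : ∀ S, μ S ≠ ∞)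
    {E : InteractionIndex d} (hE : IsFaithInteractionIndex μ E) (v : SetFun d) (h1 : 1 ≤ ℓ)
    (h2 : ℓ ≤ d) : NormalEq (fun S => (μ S).toReal) v (E v ℓ) := by
  intro y
  set x := E v ℓ with hx
  -- Moving from `x` along `y` changes the loss by a nonnegative quadratic in `t` with zero constant
  -- term; its discriminant bound kills the linear coefficient.
  have key : ∀ t : ℝ, 0 ≤ (∑ S, (μ S).toReal * approx y S ^ 2) * (t * t) +
      (-2 * ∑ S, (μ S).toReal * (v S - approx x S) * approx y S) * t + 0 := by
    intro t
    have h := hE.isMinOn v ℓ h1 h2 (show x + t • y ∈ feasible ℓ μ v from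
      fun S hS => absurd hS (hμ S))
    simp only [Set.mem_ofPred_eq, loss, ← hx, approx_add_smul, ne_eq, hμ, not_false_eq_true,
      Finset.filter_true] at h
    rw [← sub_nonneg, ← Finset.sum_sub_distrib] at h
    refine h.trans_eq ?_
    simp only [Finset.sum_mul, Finset.mul_sum, add_zero, ← Finset.sum_add_distrib]
    exact Finset.sum_congr rfl fun S _ => by ring
  have := discrim_le_zero key
  rw [discrim] at this
  nlinarith [sq_nonneg (∑ S, (μ S).toReal * (v S - approx x S) * approx y S)]

end Regression

/-! ### Relabelling of features. -/

section Permutation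

variable {d ℓ : ℕ}

/-- The coefficient vector with its features relabelled by `σ`. -/
def permute (σ : Equiv.Perm (Fin d)) (x : Coalition d ℓ → ℝ) : Coalition d ℓ → ℝ :=
  fun T => x ⟨σ.finsetCongr T.1, by simpa using T.2⟩

lemma coeff_permute (σ : Equiv.Perm (Fin d)) (x : Coalition d ℓ → ℝ) (T : Finset (Fin d)) :
    coeff (permute σ x) T = coeff x (σ.finsetCongr T) := by
  have hc : (σ.finsetCongr T).card = T.card := by simp
  rcases le_or_gt T.card ℓ with h | h
  · rw [coeff_of_le _ h, coeff_of_le _ (hc.trans_le h), permute]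
  · rw [coeff_of_lt _ h, coeff_of_lt _ (h.trans_eq hc.symm)]

lemma approx_permute (σ : Equiv.Perm (Fin d)) (x : Coalition d ℓ → ℝ) (S : Finset (Fin d)) :
    approx (permute σ x) S = approx x (σ.finsetCongr S) := by
  rw [approx_eq_sum_powerset, approx_eq_sum_powerset]
  refine Finset.sum_equiv σ.finsetCongr (fun T => ?_) fun T _ => coeff_permute σ x T
  simp

lemma permute_symm_permute (σ : Equiv.Perm (Fin d)) (x : Coalition d ℓ → ℝ) :
    permute σ (permute σ.symm x) = x := by
  funext T
  simp only [permute]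
  congr 1
  apply Subtype.ext
  exact σ.finsetCongr.symm_apply_apply T.1

lemma NormalEq.permute {m : Finset (Fin d) → ℝ} {v : SetFun d} {x : Coalition d ℓ → ℝ}
    (h : NormalEq m v x) (σ : Equiv.Perm (Fin d)) (hm : ∀ S, m (σ.finsetCongr S) = m S)
    (hv : ∀ S, v (σ.finsetCongr S) = v S) : NormalEq m v (permute σ x) := by
  intro y
  rw [← h (FaithInteraction.permute σ.symm y)]
  refine Fintype.sum_equiv σ.finsetCongr _ _ fun S => ?_
  rw [hm, hv, approx_permute, ← approx_permute σ (FaithInteraction.permute σ.symm y),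
    permute_symm_permute]

lemma finsetCongr_swap_insert {i j : Fin d} {T : Finset (Fin d)} (hi : i ∉ T) (hj : j ∉ T) :
    (Equiv.swap i j).finsetCongr (insert i T) = insert j T := by
  ext k
  simp only [Equiv.finsetCongr_apply, Finset.mem_map_equiv, Equiv.symm_swap, Finset.mem_insert]
  rcases eq_or_ne k i with rfl | hki
  · simp [hi, hj, eq_comm]
  · rcases eq_or_ne k j with rfl | hkj
    · simp
    · simp [Equiv.swap_apply_of_ne_of_ne hki hkj, hki, hkj]

lemma apply_finsetCongr_swap {β : Type*} {f : Finset (Fin d) → β} {i j : Fin d}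
    (h : ∀ T, i ∉ T → j ∉ T → f (insert i T) = f (insert j T)) (T : Finset (Fin d)) :
    f ((Equiv.swap i j).finsetCongr T) = f T := by
  by_cases hi : i ∈ T <;> by_cases hj : j ∈ T
  · congr 1
    ext k
    simp only [Equiv.finsetCongr_apply, Finset.mem_map_equiv, Equiv.symm_swap]
    by_cases hki : k = i
    · simp [hki, hi, hj]
    by_cases hkj : k = j
    · simp [hkj, hi, hj]
    rw [Equiv.swap_apply_of_ne_of_ne hki hkj]
  · rw [← Finset.insert_erase hi, finsetCongr_swap_insert (by simp) (by simp [hj]),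
      h _ (by simp) (by simp [hj])]
  · rw [← Finset.insert_erase hj, Equiv.swap_comm,
      finsetCongr_swap_insert (by simp) (by simp [hi]), h _ (by simp [hi]) (by simp)]
  · congr 1
    ext k
    simp only [Equiv.finsetCongr_apply, Finset.mem_map_equiv, Equiv.symm_swap]
    by_cases hki : k = i
    · simp [hki, hi, hj]
    by_cases hkj : k = j
    · simp [hkj, hi, hj]
    rw [Equiv.swap_apply_of_ne_of_ne hki hkj]

/-- A function of coalitions that is unchanged by exchanging one feature depends on the size
only. -/
lemma apply_eq_of_card_eq {β : Type*} {f : Finset (Fin d) → β}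
    (h : ∀ i j T, i ∉ T → j ∉ T → f (insert i T) = f (insert j T)) {S S' : Finset (Fin d)}
    (hS : S.card = S'.card) : f S = f S' := by
  induction hn : (S \ S').card generalizing S with
  | zero =>
    rw [Finset.card_eq_zero, Finset.sdiff_eq_empty_iff_subset] at hn
    rw [Finset.eq_of_subset_of_card_le hn hS.ge]
  | succ n ih =>
    obtain ⟨i, hi⟩ : (S \ S').Nonempty := Finset.card_pos.1 (by omega)
    obtain ⟨j, hj⟩ : (S' \ S).Nonempty :=
      Finset.card_pos.1 (by rw [← Finset.card_sdiff_comm hS]; omega)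
    rw [Finset.mem_sdiff] at hi hj
    have hjS : j ∉ S.erase i := by simp [hj.2]
    rw [← ih (S := insert j (S.erase i)), ← h i j _ (by simp) hjS, Finset.insert_erase hi.1]
    · rw [Finset.card_insert_of_notMem hjS, Finset.card_erase_add_one hi.1, hS]
    · rw [Finset.insert_sdiff_of_mem _ hj.1, Finset.erase_sdiff_comm,
        Finset.card_erase_of_mem (Finset.mem_sdiff.2 hi), hn]
      rfl

end Permutation

/-! ### Affine weights and the two-parameter family. -/

section Weights

open Finset

/-- Iterated differences of `i ↦ ∏ j < i, (A + j C) / (A + B + j C)`. -/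
lemma fwdDiff_iter_prod_div {A B C : ℝ} (k s : ℕ)
    (h : ∀ j : ℕ, j < s + k → A + B + j * C ≠ 0) :
    (fwdDiff 1)^[k] (fun i : ℕ => ∏ j ∈ range i, (A + j * C) / (A + B + j * C)) s =
      (-1) ^ k * ((∏ j ∈ range s, (A + j * C)) * ∏ j ∈ range k, (B + j * C)) /
        ∏ j ∈ range (s + k), (A + B + j * C) := by
  induction k generalizing s with
  | zero => simp [prod_div_distrib]
  | succ k ih =>
    have hne : ∏ j ∈ range (s + k), (A + B + j * C) ≠ 0 :=
      prod_ne_zero_iff.2 fun j hj => h j (by have := mem_range.1 hj; omega)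
    have hlast := h (s + k) (by omega)
    -- The inductive step reduces to `(A + sC) - (A + B + (s + k)C) = -(B + kC)`.
    rw [Function.iterate_succ_apply', fwdDiff, ih s fun j hj => h j (by omega),
      ih (s + 1) fun j hj => h j (by omega), show s + 1 + k = s + k + 1 by ring,
      ← add_assoc, prod_range_succ _ (s + k), prod_range_succ _ s, prod_range_succ _ k, pow_succ]
    push_cast at hlast ⊢
    generalize ∏ j ∈ range (s + k), (A + B + j * C) = P at hne ⊢
    generalize ∏ j ∈ range s, (A + j * C) = Q
    generalize ∏ j ∈ range k, (B + j * C) = R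
    generalize hX : A + B + (s + k) * C = X at hlast ⊢
    field_simp
    rw [← hX]
    ring

lemma g_eq_prod {a b A C D l : ℝ} (hl : l ≠ 0) (hA : a * (a - b) = l * A) (hD : a - b = l * D)
    (hC : b - a ^ 2 = l * C) (i : ℕ) :
    g a b i = ∏ j ∈ range i, (A + j * C) / (D + j * C) := by
  refine prod_congr rfl fun j _ => ?_
  rw [hA, hC, hD, show l * A + j * (l * C) = l * (A + j * C) by ring,
    show l * D + j * (l * C) = l * (D + j * C) by ring, mul_div_mul_left _ _ hl]

/-- Up to the sign `(-1) ^ (d - |S|)`, the defining sum is the forward difference of order `d - |S|`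
of `g` at `|S|`. The scale `l` is free because `g` is a product of ratios. -/
lemma weight_eq_prod {d : ℕ} {a b A B C l : ℝ} (hl : l ≠ 0) (hA : a * (a - b) = l * A)
    (hD : a - b = l * (A + B)) (hC : b - a ^ 2 = l * C)
    (h : ∀ j : ℕ, j < d → A + B + j * C ≠ 0) (S : Finset (Fin d)) :
    weight a b S = (∏ j ∈ range S.card, (A + j * C)) * (∏ j ∈ range (d - S.card), (B + j * C)) /
        ∏ j ∈ range d, (A + B + j * C) := by
  have hS : S.card ≤ d := by simpa using card_le_univ S
  have h1 := fwdDiff_iter_prod_div (A := A) (B := B) (C := C) (d - S.card) S.card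
    fun j hj => h j (by omega)
  rw [fwdDiff_iter_eq_sum_shift, Nat.add_sub_cancel' hS, mul_div_assoc] at h1
  have hsq : ((-1 : ℝ) ^ (d - S.card)) * (-1) ^ (d - S.card) = 1 := by
    rw [← mul_pow]; simp
  have h2 := congrArg (fun t => (-1 : ℝ) ^ (d - S.card) * t) h1
  simp only [← mul_assoc, hsq, one_mul] at h2
  rw [← h2, weight, ← Finset.Ico_add_one_right_eq_Icc, sum_Ico_eq_sum_range,
    show d + 1 - S.card = d - S.card + 1 by omega, mul_sum]
  refine sum_congr rfl fun k hk => ?_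
  have hk' : k ≤ d - S.card := by have := mem_range.1 hk; omega
  rw [Nat.add_sub_cancel_left, g_eq_prod hl hA hD hC, zsmul_eq_mul]
  have hpow : ((-1 : ℝ) ^ (d - S.card)) = (-1) ^ (d - S.card - k) * (-1) ^ k := by
    rw [← pow_add]; congr 1; omega
  have hsq' : ((-1 : ℝ) ^ (d - S.card - k)) * (-1) ^ (d - S.card - k) = 1 := by
    rw [← mul_pow]; simp
  push_cast
  rw [hpow, smul_eq_mul, mul_one]
  linear_combination (-((d - S.card).choose k : ℝ) * (-1) ^ k *
    ∏ j ∈ range (S.card + k), (A + j * C) / (A + B + j * C)) * hsq'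

/-- A sequence whose alternating binomial sums of order at least two vanish is affine. -/
lemma exists_affine_of_alternating_sum {n : ℕ} {h : ℕ → ℝ}
    (hh : ∀ u, 2 ≤ u → u ≤ n → ∑ k ∈ range (u + 1), u.choose k • ((-1) ^ k * h k) = 0) :
    ∃ α β : ℝ, ∀ k ≤ n, h k = α + β * k := by
  -- The alternating sums are the forward differences at `0`, so Newton's expansion stops after the
  -- linear term.
  have hz : ∀ u, 2 ≤ u → u ≤ n → (fwdDiff 1)^[u] h 0 = 0 := by
    intro u h2 hu
    have h1 := congrArg (fun t => (-1 : ℝ) ^ u * t) (hh u h2 hu)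
    simp only [mul_zero, mul_sum] at h1
    rw [fwdDiff_iter_eq_sum_shift, ← h1]
    refine sum_congr rfl fun k hk => ?_
    have hk' : k ≤ u := by have := mem_range.1 hk; omega
    have hpow : ((-1 : ℝ) ^ u) = (-1) ^ (u - k) * (-1) ^ k := by
      rw [← pow_add]; congr 1; omega
    have hsq : ((-1 : ℝ) ^ k) * (-1) ^ k = 1 := by
      rw [← mul_pow]; simp
    rw [zsmul_eq_mul, nsmul_eq_mul, nsmul_eq_mul, hpow, zero_add, mul_one, Nat.cast_id]
    push_cast
    linear_combination (-(-1) ^ (u - k) * (u.choose k : ℝ) * h k) * hsq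
  refine ⟨h 0, fwdDiff 1 h 0, fun k hk => ?_⟩
  have h1 := shift_eq_sum_fwdDiff_iter 1 h k 0
  rw [zero_add, smul_eq_mul, mul_one] at h1
  rw [h1]
  rcases k with - | k
  · simp
  · rw [← sum_erase_add _ _ (mem_range.2 (Nat.succ_pos _) : 0 ∈ range (k + 1 + 1)),
      sum_eq_single_of_mem 1 (by simp)]
    · simp [mul_comm, add_comm]
    · intro u hu hne
      simp only [mem_erase, mem_range] at hu
      rw [hz u (by omega) (by omega), smul_zero]

/-- The equations determine `G` recursively from `G ∅`, and the signs `(-1) ^ K.card` solve them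
too. -/
lemma eq_neg_one_pow_mul_of_sum_powerset_eq_zero {α : Type*} [DecidableEq α] {G : Finset α → ℝ}
    {N : Finset α} (h : ∀ U ⊆ N, U.Nonempty → ∑ K ∈ U.powerset, G K = 0) (U : Finset α)
    (hU : U ⊆ N) : G U = (-1) ^ U.card * G ∅ := by
  induction U using Finset.strongInduction with
  | H U ih =>
    rcases U.eq_empty_or_nonempty with rfl | hne
    · simp
    have h1 : ∑ K ∈ U.powerset, (-1 : ℝ) ^ K.card = 0 := by
      exact_mod_cast sum_powerset_neg_one_pow_card_of_nonempty hne
    have h2 : ∑ K ∈ U.powerset, (G K - (-1) ^ K.card * G ∅) = 0 := by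
      rw [sum_sub_distrib, h U hU hne, ← sum_mul, h1]; simp
    rw [sum_eq_single_of_mem U (mem_powerset_self U)] at h2
    · linarith
    · intro K hK hKU
      have hss : K ⊂ U := (mem_powerset.1 hK).ssubset_of_ne hKU
      rw [ih K hss (hss.1.trans hU), sub_self]

/-- The weight `M (s + 1)` is an affine multiple of `M s + M (s + 1)`: conditionally on the other
features, a feature is present with a probability affine in the number of those present. -/
def IsAffineWeight (d : ℕ) (M : ℕ → ℝ) : Prop :=
  ∃ α β : ℝ, ∀ s : ℕ, s < d → M (s + 1) = (α + β * s) * (M s + M (s + 1))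

/-- The solution of the recursion that defines affine weights. -/
lemma apply_mul_prod_eq {d : ℕ} {M : ℕ → ℝ} {A B C : ℝ}
    (hB : ∀ j : ℕ, j < d → B + j * C ≠ 0)
    (h : ∀ s : ℕ, s < d → M (s + 1) * (B + (d - 1 - s : ℕ) * C) = M s * (A + s * C)) (s : ℕ)
    (hs : s ≤ d) :
    M s * ∏ j ∈ range d, (B + j * C) =
      M 0 * ((∏ j ∈ range s, (A + j * C)) * ∏ j ∈ range (d - s), (B + j * C)) := by
  induction s with
  | zero => simp
  | succ s ih =>
    have ih := ih (by omega)
    have h1 := h s (by omega)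
    have h2 := hB (d - 1 - s) (by omega)
    rw [show d - s = d - 1 - s + 1 by omega, prod_range_succ] at ih
    rw [prod_range_succ, show d - (s + 1) = d - 1 - s by omega]
    apply mul_right_cancel₀ h2
    linear_combination (∏ j ∈ range d, (B + j * C)) * h1 + (A + s * C) * ih

lemma exists_weight_eq_of_pos {d : ℕ} {M : ℕ → ℝ} (hM : 0 < M 0) {A B C : ℝ} (hA : 0 < A)
    (hB : 0 < B) (hAC : 0 < A + C) (hAj : ∀ j : ℕ, j < d → 0 < A + j * C)
    (hBj : ∀ j : ℕ, j < d → 0 < B + j * C)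
    (h : ∀ s : ℕ, s < d → M (s + 1) * (B + (d - 1 - s : ℕ) * C) = M s * (A + s * C)) :
    ∃ a b : ℝ, 0 < b ∧ b < a ∧ (∀ j : ℕ, j < d → a - b + j * (b - a ^ 2) ≠ 0) ∧
      (∀ S : Finset (Fin d), 0 < weight a b S) ∧
        ∃ c : ℝ, 0 < c ∧ ∀ S : Finset (Fin d), M S.card = c * weight a b S := by
  have hD : 0 < A + B := by linarith
  have hDC : 0 < A + B + C := by linarith
  have hDj : ∀ j : ℕ, j < d → 0 < A + B + j * C := fun j hj => by linarith [hAj j hj]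
  -- In the urn picture `a` and `b` are the probabilities that one given feature, respectively two,
  -- are present: the values of `g` at 1 and 2. The scale `l` matches `(a(a - b), a - b, b - a²)`
  -- with `(A, A + B, C)`.
  set a := A / (A + B) with ha
  set b := a * ((A + C) / (A + B + C)) with hb
  set l := a * B / ((A + B) * (A + B + C)) with hl
  have ha0 : 0 < a := by positivity
  have hl0 : 0 < l := by positivity
  have e1 : a * (a - b) = l * A := by rw [hl, hb, ha]; field_simp; ring
  have e2 : a - b = l * (A + B) := by rw [hl, hb, ha]; field_simp; ring
  have e3 : b - a ^ 2 = l * C := by rw [hl, hb, ha]; field_simp; ring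
  have hw := weight_eq_prod (d := d) hl0.ne' e1 e2 e3 fun j hj => (hDj j hj).ne'
  have hPB : 0 < ∏ j ∈ range d, (B + j * C) :=
    prod_pos fun j hj => hBj j (mem_range.1 hj)
  have hPD : 0 < ∏ j ∈ range d, (A + B + j * C) :=
    prod_pos fun j hj => hDj j (mem_range.1 hj)
  have hcard : ∀ S : Finset (Fin d), S.card ≤ d := fun S => by simpa using card_le_univ S
  refine ⟨a, b, by positivity, ?_, fun j hj => ?_, fun S => ?_,
    M 0 * (∏ j ∈ range d, (A + B + j * C)) / ∏ j ∈ range d, (B + j * C), by positivity,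
    fun S => ?_⟩
  · have : 0 < a - b := by rw [e2]; positivity
    linarith
  · rw [e2, e3, show l * (A + B) + j * (l * C) = l * (A + B + j * C) by ring]
    exact (mul_pos hl0 (hDj j hj)).ne'
  · rw [hw]
    refine div_pos (mul_pos (prod_pos fun j hj => hAj j ?_) (prod_pos fun j hj => hBj j ?_)) hPD
    · exact (mem_range.1 hj).trans_le (hcard S)
    · exact (mem_range.1 hj).trans_le (Nat.sub_le _ _)
  · have h1 := apply_mul_prod_eq (fun j hj => (hBj j hj).ne') h S.card (hcard S)
    rw [hw, div_mul_div_comm, eq_div_iff (mul_pos hPB hPD).ne']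
    linear_combination (∏ j ∈ range d, (A + B + j * C)) * h1

/-- Positive affine weights are proportional to a member of the two-parameter family. -/
lemma IsAffineWeight.exists_weight_eq {d : ℕ} {M : ℕ → ℝ} (hM : ∀ s, 0 < M s)
    (h : IsAffineWeight d M) :
    ∃ a b : ℝ, 0 < b ∧ b < a ∧ (∀ j : ℕ, j < d → a - b + j * (b - a ^ 2) ≠ 0) ∧
      (∀ S : Finset (Fin d), 0 < weight a b S) ∧
        ∃ c : ℝ, 0 < c ∧ ∀ S : Finset (Fin d), M S.card = c * weight a b S := by
  rcases Nat.lt_or_ge d 2 with hd | hd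
  -- At most one recursion equation exists here, so `C = 0` suffices; `A + C > 0` could not be read
  -- off at `s = 1`.
  · refine exists_weight_eq_of_pos (hM 0) (A := M 1) (B := M 0) (C := 0) (hM 1) (hM 0)
      (by simpa using hM 1) (fun j _ => by simpa using hM 1) (fun j _ => by simpa using hM 0) ?_
    intro s hs
    obtain rfl : s = 0 := by omega
    simp [mul_comm]
  · obtain ⟨α, β, h⟩ := h
    have hA : ∀ s : ℕ, s < d → 0 < α + s * β := fun s hs => by
      have h1 := h s hs
      have h2 := hM (s + 1)
      rw [h1, mul_comm β] at h2
      exact pos_of_mul_pos_left h2 (add_pos (hM s) (hM (s + 1))).le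
    have hB : ∀ s : ℕ, s < d → 0 < 1 - α - s * β := fun s hs => by
      have h1 := h s hs
      have h2 : 0 < (1 - α - s * β) * (M s + M (s + 1)) := by nlinarith [hM s]
      exact pos_of_mul_pos_left h2 (add_pos (hM s) (hM (s + 1))).le
    have hcast : ∀ j : ℕ, j < d → ((d - 1 - j : ℕ) : ℝ) = ((d - 1 : ℕ) : ℝ) - j := fun j hj =>
      Nat.cast_sub (by omega)
    have h0 := hA 0 (by omega)
    have h1 := hA 1 (by omega)
    simp only [Nat.cast_zero, zero_mul, add_zero, Nat.cast_one, one_mul] at h0 h1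
    -- Normalised by `A + B + (d - 1)C = 1`, so that `B + (d - 1 - s)C = 1 - α - sβ`.
    refine exists_weight_eq_of_pos (hM 0) (A := α) (B := 1 - α - (d - 1 : ℕ) * β) (C := β) h0
      (hB _ (by omega)) h1 hA (fun j hj => ?_) fun s hs => ?_
    · have := hB (d - 1 - j) (by omega)
      rw [hcast j hj] at this
      linarith
    · rw [hcast s hs]
      linear_combination h s hs

/-- The weights of the two-parameter family are affine. -/
lemma weight_insert_eq {d : ℕ} {a b : ℝ}
    (h : ∀ j : ℕ, j < d → a - b + j * (b - a ^ 2) ≠ 0) :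
    ∃ α β : ℝ, ∀ (S : Finset (Fin d)) (i : Fin d), i ∉ S →
      weight a b (insert i S) = (α + β * S.card) * (weight a b S + weight a b (insert i S)) := by
  set A := a * (a - b) with hA
  set B := (1 - a) * (a - b) with hB
  set C := b - a ^ 2 with hC
  have hAB : a - b = A + B := by rw [hA, hB]; ring
  have hD : ∀ j : ℕ, j < d → A + B + j * C ≠ 0 := fun j hj => hAB ▸ h j hj
  have hw := weight_eq_prod (d := d) (a := a) (b := b) (l := 1) one_ne_zero (by rw [one_mul])
    (by rw [one_mul, hAB]) (by rw [one_mul]) hD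
  refine ⟨A / (A + B + (d - 1 : ℕ) * C), C / (A + B + (d - 1 : ℕ) * C), fun S i hi => ?_⟩
  have hlt : S.card < d := by
    have := card_le_univ (insert i S)
    rw [card_insert_of_notMem hi, Fintype.card_fin] at this
    omega
  have hE := hD (d - 1) (by omega)
  have hP : ∏ j ∈ range d, (A + B + j * C) ≠ 0 :=
    prod_ne_zero_iff.2 fun j hj => hD j (mem_range.1 hj)
  have hcast : ((d - 1 - S.card : ℕ) : ℝ) = ((d - 1 : ℕ) : ℝ) - S.card := Nat.cast_sub (by omega)
  rw [hw, hw, card_insert_of_notMem hi, show d - S.card = d - 1 - S.card + 1 by omega,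
    show d - (S.card + 1) = d - 1 - S.card by omega, prod_range_succ, prod_range_succ, hcast]
  generalize ∏ j ∈ range d, (A + B + j * C) = P at hP ⊢
  generalize ∏ j ∈ range S.card, (A + j * C) = Q
  generalize ∏ j ∈ range (d - 1 - S.card), (B + j * C) = R
  generalize hX : A + B + (d - 1 : ℕ) * C = X at hE ⊢
  field_simp
  rw [← hX]
  ring

end Weights

/-! ### From the axioms to affine weights. -/

section Necessity

open Finset

variable {d : ℕ}

/-- Interaction symmetry forces the weights to depend on the size only. -/
lemma InteractionSymmetry.weight_eq_of_card_eq {m : Finset (Fin d) → ℝ} (hm : ∀ S, 0 < m S)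
    {E : InteractionIndex d} (hE : ∀ v ℓ, 1 ≤ ℓ → ℓ ≤ d → NormalEq m v (E v ℓ)) (hd : 2 ≤ d)
    (hsym : InteractionSymmetry E) {S S' : Finset (Fin d)} (hS : S.card = S'.card) :
    m S = m S' := by
  -- The monomial of degree `d`, fitted at order `d - 1`: `NormalEq.sum_compl` then applies to every
  -- nonempty `U`.
  set v : SetFun d := fun S => if S = univ then 1 else 0 with hv
  set x := E v (d - 1)
  have hx : NormalEq m v x := hE v (d - 1) (by omega) (by omega)
  have hvij : ∀ (i j : Fin d) (T : Finset (Fin d)), i ∉ T → j ∉ T →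
      v (insert i T) = v (insert j T) := by
    intro i j T hi hj
    rcases eq_or_ne i j with rfl | hij
    · rfl
    · have h1 : insert i T ≠ univ := fun h => by
        have := h ▸ mem_univ j
        simp [hij.symm, hj] at this
      have h2 : insert j T ≠ univ := fun h => by
        have := h ▸ mem_univ i
        simp [hij, hi] at this
      simp [hv, h1, h2]
  have halt : ∀ S, m S * (v S - approx x S) =
      (-1) ^ Sᶜ.card * (m univ * (v univ - approx x univ)) := by
    intro S
    have := eq_neg_one_pow_mul_of_sum_powerset_eq_zero
      (G := fun K => m Kᶜ * (v Kᶜ - approx x Kᶜ)) (N := univ)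
      (fun U _ hU => hx.sum_compl (by have := hU.card_pos; omega)) Sᶜ (subset_univ _)
    simpa only [compl_compl, compl_empty] using this
  -- Otherwise the fit is exact, and since `v` vanishes on all coalitions of size at most `d - 1`,
  -- so does the fit, even at `univ`.
  have hc : m univ * (v univ - approx x univ) ≠ 0 := by
    intro h0
    have happ : ∀ S, approx x S = v S := fun S => by
      have h1 := halt S
      rw [h0, mul_zero, mul_eq_zero, or_iff_right (hm S).ne'] at h1
      linarith
    have hx0 : x = 0 := eq_zero_of_approx_eq_zero fun S hS => by
      rw [happ S]
      refine if_neg fun h => ?_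
      rw [h, card_univ, Fintype.card_fin] at hS
      omega
    have h1 := happ univ
    rw [hx0] at h1
    simp [hv, approx] at h1
  refine apply_eq_of_card_eq (fun i j T hi hj => ?_) hS
  have hxs : ∀ T, coeff x ((Equiv.swap i j).finsetCongr T) = coeff x T := by
    refine apply_finsetCongr_swap fun T hi hj => ?_
    have hci : (insert i T).card = T.card + 1 := card_insert_of_notMem hi
    have hcj : (insert j T).card = T.card + 1 := card_insert_of_notMem hj
    rcases Nat.lt_or_ge T.card (d - 1) with hT | hT
    · rw [coeff_of_le _ (hci.trans_le hT), coeff_of_le _ (hcj.trans_le hT)]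
      exact hsym (d - 1) (by omega) (by omega) v i j (hvij i j) T hi hj hT
    · rw [coeff_of_lt _ (by omega), coeff_of_lt _ (by omega)]
  have happ : approx x (insert j T) = approx x (insert i T) := by
    rw [← finsetCongr_swap_insert hi hj, ← approx_permute, approx_eq_sum_powerset,
      approx_eq_sum_powerset]
    exact sum_congr rfl fun U _ => by rw [coeff_permute, hxs]
  have h1 := halt (insert i T)
  have h2 := halt (insert j T)
  have hne : m (insert i T) * (v (insert i T) - approx x (insert i T)) ≠ 0 := by
    rw [h1]
    exact mul_ne_zero (pow_ne_zero _ (by norm_num)) hc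
  rw [happ, ← hvij i j T hi hj, card_compl, card_insert_of_notMem hj,
    ← card_insert_of_notMem hi, ← card_compl, ← h1] at h2
  exact (mul_right_cancel₀ (right_ne_zero_of_mul hne) h2).symm

lemma approx_insert {ℓ : ℕ} (x : Coalition d ℓ → ℝ) {i : Fin d} {S : Finset (Fin d)}
    (hi : i ∉ S) :
    approx x (insert i S) = approx x S + ∑ T ∈ S.powerset, coeff x (insert i T) := by
  rw [approx_eq_sum_powerset, approx_eq_sum_powerset, sum_powerset_insert hi]

/-- Interaction dummy forces weights that depend on the size only to be affine. -/
lemma InteractionDummy.isAffineWeight {M : ℕ → ℝ} (hM : ∀ s, 0 < M s) {E : InteractionIndex d}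
    (hE : ∀ v ℓ, 1 ≤ ℓ → ℓ ≤ d → NormalEq (fun S => M S.card) v (E v ℓ))
    (hdum : InteractionDummy E) : IsAffineWeight d M := by
  rcases Nat.lt_or_ge d 3 with hd | hd
  -- At most two ratios are constrained, and a line interpolates them.
  · refine ⟨M 1 / (M 0 + M 1), M 2 / (M 1 + M 2) - M 1 / (M 0 + M 1), fun s hs => ?_⟩
    have h0 := add_pos (hM 0) (hM 1)
    have h1 := add_pos (hM 1) (hM 2)
    obtain rfl | rfl : s = 0 ∨ s = 1 := by omega
    · simp [h0.ne']
    · simp [h1.ne']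
  let i : Fin d := ⟨0, by omega⟩
  set N : Finset (Fin d) := univ.erase i with hN
  have hNc : N.card = d - 1 := by simp [hN]
  -- The monomial of degree `d - 1` that ignores `i`, fitted at order `d - 2`.
  set v : SetFun d := fun S => if N ⊆ S then 1 else 0 with hv
  have hvi : ∀ S, i ∉ S → v (insert i S) = v S := fun S _ => by
    simp [hv, hN, subset_insert_iff_of_notMem]
  set x := E v (d - 2)
  have hx : NormalEq (fun S => M S.card) v x := hE v (d - 2) (by omega) (by omega)
  have hx0 : ∀ T, i ∈ T → coeff x T = 0 := by
    intro T hT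
    rcases le_or_gt T.card (d - 2) with h | h
    · rw [coeff_of_le _ h]
      exact hdum (d - 2) (by omega) (by omega) v i hvi ⟨T, h⟩ hT
    · exact coeff_of_lt _ h
  set R : Finset (Fin d) → ℝ := fun S => v S - approx x S with hR
  have hRi : ∀ S, i ∉ S → R (insert i S) = R S := by
    intro S hS
    simp only [hR]
    rw [hvi S hS, approx_insert x hS, sum_eq_zero fun T _ => hx0 _ (mem_insert_self i T), add_zero]
  have hRc : ∀ K, i ∉ K → R (insert i K)ᶜ = R Kᶜ := by
    intro K hK
    rw [← hRi _ (by simp)]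
    congr 1
    ext j
    by_cases hj : j = i <;> simp [hj, hK]
  -- For `K ⊆ N`, the joint weighted residual of `Kᶜ` and `Kᶜ \ {i}`, where `R` agrees. Normal
  -- equations at `insert i U`, of size at least 2, make it alternate.
  set G : Finset (Fin d) → ℝ :=
    fun K => (M (d - K.card) + M (d - K.card - 1)) * R Kᶜ with hG
  have hGK : ∀ K ⊆ N, G K = M Kᶜ.card * R Kᶜ + M (insert i K)ᶜ.card * R (insert i K)ᶜ := by
    intro K hK
    have hiK : i ∉ K := fun h => by simpa [hN] using hK h
    rw [hRc K hiK, card_compl, card_compl, card_insert_of_notMem hiK, Fintype.card_fin, ← add_mul,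
      ← Nat.sub_sub]
  have halt : ∀ K ⊆ N, G K = (-1) ^ K.card * G ∅ := by
    refine eq_neg_one_pow_mul_of_sum_powerset_eq_zero fun U hU hne => ?_
    have hiU : i ∉ U := fun h => by simpa [hN] using hU h
    have h1 := hx.sum_compl (U := insert i U) (by
      have := hne.card_pos
      rw [card_insert_of_notMem hiU]
      omega)
    rw [sum_powerset_insert hiU, ← sum_add_distrib] at h1
    rw [← h1]
    exact sum_congr rfl fun K hK => hGK K ((mem_powerset.1 hK).trans hU)
  have hc : G ∅ ≠ 0 := by
    intro h0
    have h1 : ∀ S, i ∈ S → R S = 0 := by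
      intro S hS
      have h2 := halt Sᶜ fun j hj => by
        simp only [hN, mem_erase, mem_univ, and_true]
        rintro rfl
        exact (mem_compl.1 hj) hS
      rw [h0, mul_zero] at h2
      simpa [hG, (add_pos (hM _) (hM _)).ne'] using h2
    have happ : ∀ S, approx x S = v S := by
      intro S
      have h2 : R S = 0 := by
        by_cases hS : i ∈ S
        · exact h1 S hS
        · rw [← hRi S hS]
          exact h1 _ (mem_insert_self i S)
      simp only [hR] at h2
      linarith
    have hx0 : x = 0 := eq_zero_of_approx_eq_zero fun S hS => by
      rw [happ S]
      refine if_neg fun h => ?_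
      have := card_le_card h
      omega
    have h2 := happ univ
    rw [hx0] at h2
    simp [hv, approx] at h2
  -- Now `i` stays outside `U`: each term is the ratio `h |K|` times `G K = ± G ∅`, so the
  -- alternating sums of the ratios vanish for `|U| ≥ 2`.
  obtain ⟨α, β, hαβ⟩ := exists_affine_of_alternating_sum (n := d - 1)
    (h := fun k => M (d - k) / (M (d - k) + M (d - k - 1))) fun u hu hud => by
      obtain ⟨U, hUN, hUc⟩ := exists_subset_card_eq (hud.trans_eq hNc.symm)
      have h1 := hx.sum_compl (U := U) (by omega)
      rw [← hUc, ← sum_powerset_apply_card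
        fun k => (-1) ^ k * (M (d - k) / (M (d - k) + M (d - k - 1)))]
      rw [← mul_right_inj' hc, mul_zero, mul_sum, ← h1]
      refine sum_congr rfl fun K hK => ?_
      have h2 := halt K ((mem_powerset.1 hK).trans hUN)
      have h3 := add_pos (hM (d - K.card)) (hM (d - K.card - 1))
      rw [mul_left_comm, ← mul_assoc, ← h2, card_compl, Fintype.card_fin]
      simp only [hG, hR]
      field_simp
  -- Substitution of `k = d - 1 - s`, as `k` counts absent features.
  refine ⟨α + β * (d - 1 : ℕ), -β, fun s hs => ?_⟩
  have h1 := hαβ (d - 1 - s) (by omega)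
  rw [show d - (d - 1 - s) = s + 1 by omega, Nat.add_sub_cancel,
    div_eq_iff (add_pos (hM _) (hM _)).ne', Nat.cast_sub (by omega : s ≤ d - 1)] at h1
  linear_combination h1

end Necessity

/-! ### From affine weights to the axioms. -/

section Sufficiency

open Finset

variable {d ℓ : ℕ}

/-- If the conditional probability that `i` is present is affine in the number of other features
present, then the regression coefficients involving a dummy feature `i` vanish. -/
lemma NormalEq.coeff_eq_zero {m : Finset (Fin d) → ℝ} (hm : ∀ S, 0 < m S) {v : SetFun d}
    {x : Coalition d ℓ → ℝ} (hx : NormalEq m v x) {i : Fin d} {α β : ℝ}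
    (h : ∀ S, i ∉ S → m (insert i S) = (α + β * S.card) * (m S + m (insert i S)))
    (hv : ∀ S, i ∉ S → v (insert i S) = v S) {T : Finset (Fin d)} (hT : i ∈ T) :
    coeff x T = 0 := by
  set N : Finset (Fin d) := univ.erase i with hN
  have hiN : i ∉ N := notMem_erase i univ
  have hmem : ∀ S, S ∈ N.powerset ↔ i ∉ S := fun S => by
    rw [mem_powerset, hN, subset_erase]
    simp
  -- The cofactor of `i` in the fit: what adding `i` to `S` contributes.
  set q : Finset (Fin d) → ℝ :=
    fun S => ∑ U ∈ N.powerset, coeff x (insert i U) * (if U ⊆ S then 1 else 0) with hq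
  have hqS : ∀ S, i ∉ S → q S = ∑ U ∈ S.powerset, coeff x (insert i U) := by
    intro S hS
    simp only [hq, mul_ite, mul_one, mul_zero]
    rw [← sum_filter]
    refine sum_congr ?_ fun _ _ => rfl
    ext U
    rw [mem_filter, hmem, mem_powerset]
    exact ⟨fun h => h.2, fun h => ⟨fun hi => hS (h hi), h⟩⟩
  have hqi : ∀ S, q (insert i S) = q S := by
    intro S
    refine sum_congr rfl fun U hU => ?_
    simp only [subset_insert_iff_of_notMem ((hmem U).1 hU)]
  -- The test function has degree at most `|U| + 1 ≤ ℓ`, as `|S \ {i}|` is a sum of indicators of `j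
  -- ∈ S`.
  have horth : ∀ U : Finset (Fin d), i ∉ U → U.card < ℓ →
      ∑ S, m S * (v S - approx x S) * ((if U ⊆ S then 1 else 0) *
        ((if i ∈ S then 1 else 0) - α - β * (S.erase i).card)) = 0 := by
    intro U hU hUc
    have hcard : ∀ S : Finset (Fin d),
        ((S.erase i).card : ℝ) = ∑ j ∈ N, if j ∈ S then 1 else 0 := by
      intro S
      rw [← sum_filter, sum_const, nsmul_eq_mul, mul_one]
      congr 2
      ext j
      simp [hN, and_comm]
    have hins : ∀ (j : Fin d) (S : Finset (Fin d)), (if insert j U ⊆ S then (1 : ℝ) else 0) =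
        (if U ⊆ S then 1 else 0) * if j ∈ S then 1 else 0 := by
      intro j S
      by_cases h1 : j ∈ S <;> simp [insert_subset_iff, h1]
    have h1 : ∀ j, ∑ S, m S * (v S - approx x S) *
        ((if U ⊆ S then 1 else 0) * if j ∈ S then 1 else 0) = 0 := by
      intro j
      simp only [← hins]
      exact hx.sum_superset ((card_insert_le j U).trans hUc)
    have h2 := hx.sum_superset hUc.le
    have h3 : ∑ S, m S * (v S - approx x S) *
        ((if U ⊆ S then 1 else 0) * (S.erase i).card) = 0 := by
      simp only [hcard, mul_sum]
      rw [sum_comm]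
      exact sum_eq_zero fun j _ => h1 j
    calc _ = ∑ S, m S * (v S - approx x S) *
            ((if U ⊆ S then 1 else 0) * if i ∈ S then 1 else 0) -
          α * (∑ S, m S * (v S - approx x S) * (if U ⊆ S then 1 else 0)) -
          β * ∑ S, m S * (v S - approx x S) *
            ((if U ⊆ S then 1 else 0) * (S.erase i).card) := by
          rw [mul_sum, mul_sum, ← sum_sub_distrib, ← sum_sub_distrib]
          exact sum_congr rfl fun S _ => by ring
      _ = 0 := by rw [h1, h2, h3]; simp
  have hsum : ∑ S, m S * (v S - approx x S) *
      (q S * ((if i ∈ S then 1 else 0) - α - β * (S.erase i).card)) = 0 := by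
    simp only [hq, sum_mul, mul_sum]
    rw [sum_comm]
    refine sum_eq_zero fun U hU => ?_
    have hiU := (hmem U).1 hU
    rcases Nat.lt_or_ge U.card ℓ with hUc | hUc
    · refine Eq.trans ?_ (congrArg (coeff x (insert i U) * ·) (horth U hiU hUc)) |>.trans
        (mul_zero _)
      simp only [mul_sum]
      exact sum_congr rfl fun S _ => by ring
    · have h0 : coeff x (insert i U) = 0 :=
        coeff_of_lt x (by rw [card_insert_of_notMem hiU]; omega)
      simp [h0]
  -- Pairing `S` with `insert i S`, affinity cancels the common residual and leaves minus a weighted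
  -- sum of squares of `q`.
  have hpair : ∑ S ∈ N.powerset, (α + β * S.card) * m S * q S ^ 2 = 0 := by
    rw [← powerset_univ, ← insert_erase (mem_univ i), sum_powerset_insert hiN,
      ← sum_add_distrib] at hsum
    rw [← neg_eq_zero, ← hsum, ← sum_neg_distrib]
    refine sum_congr rfl fun S hS => ?_
    have hi := (hmem S).1 hS
    rw [hv S hi, approx_insert x hi, ← hqS S hi, hqi, erase_insert hi, erase_eq_of_notMem hi,
      if_neg hi, if_pos (mem_insert_self i S)]
    linear_combination (-(v S - approx x S - q S) * q S) * h S hi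
  have hpos : ∀ S : Finset (Fin d), i ∉ S → 0 < α + β * S.card := by
    intro S hS
    have h1 := hm (insert i S)
    rw [h S hS] at h1
    exact pos_of_mul_pos_left h1 (add_pos (hm S) (hm (insert i S))).le
  rw [sum_eq_zero_iff_of_nonneg fun S hS => by
    have := hpos S ((hmem S).1 hS)
    have := hm S
    positivity] at hpair
  have hq0 : ∀ S : Finset (Fin d), i ∉ S → ∑ U ∈ S.powerset, coeff x (insert i U) = 0 := by
    intro S hS
    rw [← hqS S hS]
    simpa [(hm S).ne', (hpos S hS).ne'] using hpair S ((hmem S).2 hS)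
  have key : ∀ S : Finset (Fin d), i ∉ S → coeff x (insert i S) = 0 := by
    intro S
    induction S using Finset.strongInduction with
    | H S ih =>
      intro hS
      have h1 := hq0 S hS
      rwa [sum_eq_single_of_mem S (mem_powerset_self S)] at h1
      intro U hU hne
      exact ih U ((mem_powerset.1 hU).ssubset_of_ne hne) fun hi => hS (mem_powerset.1 hU hi)
  rw [← insert_erase hT]
  exact key _ (notMem_erase i T)

lemma interactionLinearity_of_normalEq {m : Finset (Fin d) → ℝ} (hm : ∀ S, 0 < m S)
    {E : InteractionIndex d} (hE : ∀ v ℓ, 1 ≤ ℓ → ℓ ≤ d → NormalEq m v (E v ℓ)) :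
    InteractionLinearity E := by
  intro ℓ h1 h2 v₁ v₂ α₁ α₂
  refine (hE _ ℓ h1 h2).unique hm fun y => ?_
  have e1 := hE v₁ ℓ h1 h2 y
  have e2 := hE v₂ ℓ h1 h2 y
  have happ : ∀ S, approx (α₁ • E v₁ ℓ + α₂ • E v₂ ℓ) S =
      α₁ * approx (E v₁ ℓ) S + α₂ * approx (E v₂ ℓ) S := by
    intro S
    rw [approx_add_smul]
    simp [approx, mul_sum]
  have e3 := congrArg₂ (fun s t => α₁ * s + α₂ * t) e1 e2
  simp only [mul_sum, ← sum_add_distrib, mul_zero, add_zero] at e3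
  rw [← e3]
  refine sum_congr rfl fun S _ => ?_
  rw [happ]
  simp only [Pi.add_apply, Pi.smul_apply, smul_eq_mul]
  ring

lemma interactionSymmetry_of_normalEq {m : Finset (Fin d) → ℝ} (hm : ∀ S, 0 < m S)
    (hcard : ∀ S S' : Finset (Fin d), S.card = S'.card → m S = m S')
    {E : InteractionIndex d} (hE : ∀ v ℓ, 1 ≤ ℓ → ℓ ≤ d → NormalEq m v (E v ℓ)) :
    InteractionSymmetry E := by
  intro ℓ h1 h2 v i j hv T hi hj hT
  have hx := hE v ℓ h1 h2
  have h := hx.unique hm (hx.permute (Equiv.swap i j) (fun S => hcard _ _ (by simp))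
    (apply_finsetCongr_swap hv))
  have h3 := coeff_permute (Equiv.swap i j) (E v ℓ) (insert i T)
  rw [← h, finsetCongr_swap_insert hi hj] at h3
  rwa [coeff_of_le, coeff_of_le] at h3

lemma interactionDummy_of_normalEq {m : Finset (Fin d) → ℝ} (hm : ∀ S, 0 < m S) {α β : ℝ}
    (h : ∀ (S : Finset (Fin d)) (i : Fin d), i ∉ S →
      m (insert i S) = (α + β * S.card) * (m S + m (insert i S)))
    {E : InteractionIndex d} (hE : ∀ v ℓ, 1 ≤ ℓ → ℓ ≤ d → NormalEq m v (E v ℓ)) :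
    InteractionDummy E := by
  intro ℓ h1 h2 v i hv T hT
  exact (coeff_coe _ T).symm.trans
    ((hE v ℓ h1 h2).coeff_eq_zero hm (fun S hS => h S i hS) hv hT)

end Sufficiency

end FaithInteraction

theorem mainTheorem2 (d : ℕ) (μ : Finset (Fin d) → ℝ≥0∞) (hμ : ∀ S, μ S ≠ ∞)
    (E : FaithInteraction.InteractionIndex d)
    (hE : FaithInteraction.IsFaithInteractionIndex μ E) :
    (FaithInteraction.InteractionLinearity E ∧ FaithInteraction.InteractionSymmetry E ∧
        FaithInteraction.InteractionDummy E) ↔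
      ∃ a b : ℝ, 0 < b ∧ b < a ∧
        (∀ j : ℕ, j < d → a - b + j * (b - a ^ 2) ≠ 0) ∧
        (∀ S : Finset (Fin d), 0 < FaithInteraction.weight a b S) ∧
        ∃ c : ℝ, 0 < c ∧
          ∀ S : Finset (Fin d), (μ S).toReal = c * FaithInteraction.weight a b S := by
  have hm : ∀ S, 0 < (μ S).toReal := fun S => ENNReal.toReal_pos (hE.proper.pos S).ne' (hμ S)
  have hN : ∀ v ℓ, 1 ≤ ℓ → ℓ ≤ d → FaithInteraction.NormalEq (fun S => (μ S).toReal) v (E v ℓ) :=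
    fun v ℓ h1 h2 => hE.normalEq hμ v h1 h2
  constructor
  · rintro ⟨-, hsym, hdum⟩
    have hcard : ∀ S S' : Finset (Fin d), S.card = S'.card → (μ S).toReal = (μ S').toReal := by
      intro S S' hS
      rcases Nat.lt_or_ge d 2 with hd | hd
      -- For `d ≤ 1` a coalition is determined by its size.
      · congr 2
        interval_cases d
        · exact Subsingleton.elim _ _
        · have h1 : ∀ U : Finset (Fin 1), U = ∅ ∨ U = Finset.univ := by decide
          rcases h1 S with rfl | rfl <;> rcases h1 S' with rfl | rfl <;> simp_all
      · exact hsym.weight_eq_of_card_eq hm hN hd hS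
    -- Initial segments represent the sizes; beyond `d` the segment is `univ`, which keeps `M`
    -- positive everywhere.
    set M : ℕ → ℝ := fun k => (μ (Finset.univ.filter fun j : Fin d => j.1 < k)).toReal with hM
    have hMμ : ∀ S : Finset (Fin d), (μ S).toReal = M S.card := by
      intro S
      refine hcard _ _ ?_
      have : S.card ≤ d := by simpa using S.card_le_univ
      simp [Fin.card_filter_val_lt, this]
    have hMpos : ∀ s, 0 < M s := fun s => hm _
    simp only [hMμ] at hN ⊢
    exact (hdum.isAffineWeight hMpos hN).exists_weight_eq hMpos
  · rintro ⟨a, b, -, -, hne, -, c, -, hc⟩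
    obtain ⟨α, β, hαβ⟩ := FaithInteraction.weight_insert_eq hne
    refine ⟨FaithInteraction.interactionLinearity_of_normalEq hm hN,
      FaithInteraction.interactionSymmetry_of_normalEq hm (fun S S' hS => ?_) hN,
      FaithInteraction.interactionDummy_of_normalEq hm (α := α) (β := β) (fun S i hi => ?_) hN⟩
    · rw [hc, hc, FaithInteraction.weight, FaithInteraction.weight, hS]
    · rw [hc, hc, ← mul_add, mul_left_comm, ← hαβ S i hi]
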